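/- Let $E$ be a complex Banach lattice, i.e. the complexification $E = E_{\mathbb R} \oplus iE_{\mathbb R}$ of a real Banach lattice $E_{\mathbb R}$, with modulus $|x+iy| = \sup_{\theta \in \mathbb R} \big((\cos\theta)x + (\sin\theta)y\big)$ and norm $\|z\| = \|\,|z|\,\|$. Assume that $E$ is order complete, i.e. every non-empty subset of $E_{\mathbb R}$ that is bounded above has a supremum. Let $T$ be a positive bounded linear operator on $E$ with spectral radius $r(T) = 1$, and assume that $T$ is mean ergodic, i.e. the Cesàro means $\frac1n \sum_{k=0}^{n-1} T^k$ converge strongly to some bounded linear operator on $E$ as $n \to \infty$. Then $$\dim \ker(e^{i\theta} - T) \le \dim \ker(e^{in\theta} - T) \qquad \text{for all } \theta \in 2\pi\mathbb{Q} \text{ and all } n \in \mathbb{Z},$$ where the dimension of a vector space is understood as an element of $\mathbb{N}_0 \cup \{\infty\}$ (infinite cardinalities are not distinguished). In particular, the rational peripheral point spectrum $$\{r(T)e^{i\theta} : \theta \in 2\pi\mathbb{Q}\} \cap \sigma_{\mathrm{pnt}}(T)$$ of $T$, where $\sigma_{\mathrm{pnt}}(T)$ is the set of eigenvalues of $T$,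 is cyclic. Here a set $M \subset \mathbb{C}$ is called cyclic if $re^{i\theta} \in M$ with $r \ge 0$ and $\theta \in \mathbb{R}$ implies $re^{in\theta} \in M$ for every $n \in \mathbb{Z}$. -/

import Mathlib

open Filter Topology

noncomputable section

/-! ### The complexification of a real Banach lattice -/

section Modulus

variable {E : Type*} [NormedAddCommGroup E] [NormedSpace ℝ E] [Lattice E] [HasSolidNorm E]
  [IsOrderedAddMonoid E] [IsOrderedModule ℝ E]

/-- The real part of `exp (-iθ) (x + iy)`. -/
def rotRe (x y : E) (θ : ℝ) : E := Real.cos θ • x + Real.sin θ • y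

theorem smul_le_abs_smul_abs (c : ℝ) (x : E) : c • x ≤ |c| • |x| := by
  rcases le_total 0 c with h | h
  · rw [abs_of_nonneg h]
    exact smul_le_smul_of_nonneg_left (le_abs_self x) h
  · rw [abs_of_nonpos h]
    have := smul_le_smul_of_nonneg_left (neg_le_abs x) (neg_nonneg.2 h)
    simpa using this

theorem rotRe_le_add (x y : E) (θ η : ℝ) :
    rotRe x y θ ≤ rotRe x y η + |θ - η| • (|x| + |y|) := by
  have h1 : (Real.cos θ - Real.cos η) • x ≤ |θ - η| • |x| :=
    (smul_le_abs_smul_abs _ x).trans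
      (smul_le_smul_of_nonneg_right (Real.abs_cos_sub_cos_le θ η) (abs_nonneg x))
  have h2 : (Real.sin θ - Real.sin η) • y ≤ |θ - η| • |y| :=
    (smul_le_abs_smul_abs _ y).trans
      (smul_le_smul_of_nonneg_right (Real.abs_sin_sub_sin_le θ η) (abs_nonneg y))
  have h3 : rotRe x y θ = rotRe x y η +
      ((Real.cos θ - Real.cos η) • x + (Real.sin θ - Real.sin η) • y) := by
    simp only [rotRe]; module
  rw [h3, smul_add]
  gcongr

theorem rotRe_le_abs_add_abs (x y : E) (θ : ℝ) : rotRe x y θ ≤ |x| + |y| := by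
  have h1 : Real.cos θ • x ≤ |x| := (smul_le_abs_smul_abs _ x).trans <| by
    simpa using smul_le_smul_of_nonneg_right (Real.abs_cos_le_one θ) (abs_nonneg x)
  have h2 : Real.sin θ • y ≤ |y| := (smul_le_abs_smul_abs _ y).trans <| by
    simpa using smul_le_smul_of_nonneg_right (Real.abs_sin_le_one θ) (abs_nonneg y)
  exact add_le_add h1 h2

theorem rotRe_add_pi (x y : E) (θ : ℝ) : rotRe x y (θ + Real.pi) = -rotRe x y θ := by
  simp only [rotRe, Real.cos_add_pi, Real.sin_add_pi]; module

theorem rotRe_periodic (x y : E) : Function.Periodic (rotRe x y) (2 * Real.pi) := by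
  intro θ
  simp [rotRe]

/-- In a Banach lattice the supremum that defines the modulus of `x + iy` always exists. -/
theorem exists_isLUB_rotRe [CompleteSpace E] (x y : E) :
    ∃ m : E, IsLUB (Set.range (rotRe x y)) m := by
  set u : E := |x| + |y| with hu
  have hu0 : 0 ≤ u := add_nonneg (abs_nonneg x) (abs_nonneg y)
  let δ : ℕ → ℝ := fun n => 2 * Real.pi / ((n : ℝ) + 1)
  have hδ0 : ∀ n, 0 < δ n := fun n => by positivity
  have hδ : Tendsto δ atTop (𝓝 0) := by
    have := (tendsto_one_div_add_atTop_nhds_zero_nat (𝕜 := ℝ)).const_mul (2 * Real.pi)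
    simpa [δ, div_eq_mul_inv] using this
  let S : ℕ → E := fun n =>
    (Finset.range (n + 1)).sup' Finset.nonempty_range_add_one (fun k => rotRe x y (k * δ n))
  have hS : ∀ n θ, rotRe x y θ ≤ S n + δ n • u := by
    intro n θ
    obtain ⟨η, hη, hθ⟩ := (rotRe_periodic x y).exists_mem_Ico₀ (by positivity) θ
    rw [hθ]
    have hk0 : 0 ≤ η / δ n := div_nonneg hη.1 (hδ0 n).le
    have hk1 : η / δ n < (n : ℝ) + 1 := by
      rw [div_lt_iff₀ (hδ0 n)]
      have : ((n : ℝ) + 1) * δ n = 2 * Real.pi := by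
        simp only [δ]; field_simp
      rw [this]; exact hη.2
    set k := ⌊η / δ n⌋₊ with hk
    have hkn : k < n + 1 := by
      rw [hk, Nat.floor_lt hk0]; exact_mod_cast hk1
    have hle : (k : ℝ) * δ n ≤ η := by
      rw [← le_div_iff₀ (hδ0 n)]; exact Nat.floor_le hk0
    have hlt : η < (k + 1 : ℝ) * δ n := by
      rw [← div_lt_iff₀ (hδ0 n)]; exact Nat.lt_floor_add_one _
    have hd : |η - k * δ n| ≤ δ n := by
      rw [abs_of_nonneg (by linarith)]; linarith
    calc rotRe x y η ≤ rotRe x y (k * δ n) + |η - k * δ n| • u := rotRe_le_add x y _ _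
      _ ≤ S n + δ n • u := by
        refine add_le_add ?_ (smul_le_smul_of_nonneg_right hd hu0)
        exact Finset.le_sup' (fun k : ℕ => rotRe x y (k * δ n)) (Finset.mem_range.2 hkn)
  have hSS : ∀ m n, S m ≤ S n + δ n • u := fun m n =>
    Finset.sup'_le _ _ fun k _ => hS n _
  have hdist : ∀ m n, ‖S m - S n‖ ≤ (δ m + δ n) * ‖u‖ := by
    intro m n
    have h1 : |S m - S n| ≤ |(δ m + δ n) • u| := by
      have hpos : 0 ≤ (δ m + δ n) • u := smul_nonneg (add_pos (hδ0 m) (hδ0 n)).le hu0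
      rw [abs_of_nonneg hpos, abs_le', add_smul]
      constructor
      · rw [sub_le_iff_le_add']
        refine (hSS m n).trans ?_
        gcongr
        exact le_add_of_nonneg_left (smul_nonneg (hδ0 m).le hu0)
      · rw [neg_sub, sub_le_iff_le_add']
        refine (hSS n m).trans ?_
        gcongr
        exact le_add_of_nonneg_right (smul_nonneg (hδ0 n).le hu0)
    have h2 := norm_le_norm_of_abs_le_abs h1
    rwa [norm_smul, Real.norm_of_nonneg (add_pos (hδ0 m) (hδ0 n)).le] at h2
  have hC : CauchySeq S := by
    have hb : Tendsto (fun p : ℕ × ℕ => (δ p.1 + δ p.2) * ‖u‖) atTop (𝓝 0) := by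
      have h1 : Tendsto (fun p : ℕ × ℕ => δ p.1) atTop (𝓝 0) := by
        rw [← prod_atTop_atTop_eq]; exact hδ.comp tendsto_fst
      have h2 : Tendsto (fun p : ℕ × ℕ => δ p.2) atTop (𝓝 0) := by
        rw [← prod_atTop_atTop_eq]; exact hδ.comp tendsto_snd
      simpa using (h1.add h2).mul_const ‖u‖
    rw [Metric.cauchySeq_iff]
    intro ε hε
    have hδs : Tendsto (fun n => δ n * ‖u‖) atTop (𝓝 0) := by simpa using hδ.mul_const ‖u‖
    obtain ⟨N, hN⟩ := eventually_atTop.1 (hδs.eventually (gt_mem_nhds (half_pos hε)))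
    refine ⟨N, fun m hm n hn => ?_⟩
    rw [dist_eq_norm]
    have := hdist m n
    have := hN m hm
    have := hN n hn
    linarith [add_mul (δ m) (δ n) ‖u‖]
  obtain ⟨a, ha⟩ := cauchySeq_tendsto_of_complete hC
  refine ⟨a, ?_, ?_⟩
  · rintro _ ⟨θ, rfl⟩
    have hlim : Tendsto (fun n => S n + δ n • u) atTop (𝓝 a) := by
      simpa using ha.add (hδ.smul_const u)
    exact ge_of_tendsto' hlim fun n => hS n θ
  · intro b hb
    exact le_of_tendsto' ha fun n => Finset.sup'_le _ _ fun k _ => hb ⟨_, rfl⟩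

end Modulus

/-- The complexification `E ⊕ iE` of a real vector space `E`. If `E` is a real Banach lattice,
it is given below the structure of a complex Banach space; these are the complex Banach
lattices. -/
@[ext]
structure Complexification (E : Type*) where
  /-- the real part -/
  re : E
  /-- the imaginary part -/
  im : E

namespace Complexification

section Algebra

variable {E : Type*} [AddCommGroup E]

instance : Zero (Complexification E) := ⟨⟨0, 0⟩⟩
instance : Add (Complexification E) := ⟨fun z w => ⟨z.re + w.re, z.im + w.im⟩⟩
instance : Neg (Complexification E) := ⟨fun z => ⟨-z.re, -z.im⟩⟩
instance : Sub (Complexification E) := ⟨fun z w => ⟨z.re - w.re, z.im - w.im⟩⟩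

@[simp] theorem zero_re : (0 : Complexification E).re = 0 := rfl
@[simp] theorem zero_im : (0 : Complexification E).im = 0 := rfl
@[simp] theorem add_re (z w : Complexification E) : (z + w).re = z.re + w.re := rfl
@[simp] theorem add_im (z w : Complexification E) : (z + w).im = z.im + w.im := rfl
@[simp] theorem neg_re (z : Complexification E) : (-z).re = -z.re := rfl
@[simp] theorem neg_im (z : Complexification E) : (-z).im = -z.im := rfl
@[simp] theorem sub_re (z w : Complexification E) : (z - w).re = z.re - w.re := rfl
@[simp] theorem sub_im (z w : Complexification E) : (z - w).im = z.im - w.im := rfl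

instance : AddCommGroup (Complexification E) where
  add_assoc a b c := by ext <;> simp [add_assoc]
  zero_add a := by ext <;> simp
  add_zero a := by ext <;> simp
  add_comm a b := by ext <;> simp [add_comm]
  neg_add_cancel a := by ext <;> simp
  sub_eq_add_neg a b := by ext <;> simp [sub_eq_add_neg]
  nsmul := nsmulRec
  zsmul := zsmulRec

variable [Module ℝ E]

instance : SMul ℂ (Complexification E) :=
  ⟨fun c z => ⟨c.re • z.re - c.im • z.im, c.re • z.im + c.im • z.re⟩⟩

@[simp] theorem smul_re (c : ℂ) (z : Complexification E) :
    (c • z).re = c.re • z.re - c.im • z.im := rfl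
@[simp] theorem smul_im (c : ℂ) (z : Complexification E) :
    (c • z).im = c.re • z.im + c.im • z.re := rfl

instance : Module ℂ (Complexification E) where
  one_smul a := by ext <;> simp
  mul_smul c d a := by
    ext
    · simp only [smul_re, smul_im, Complex.mul_re, Complex.mul_im]; module
    · simp only [smul_re, smul_im, Complex.mul_re, Complex.mul_im]; module
  smul_zero c := by ext <;> simp
  smul_add c a b := by
    ext
    · simp only [smul_re, add_re, add_im]; module
    · simp only [smul_im, add_re, add_im]; module
  add_smul c d a := by
    ext
    · simp only [smul_re, add_re, Complex.add_re, Complex.add_im]; module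
    · simp only [smul_im, add_im, Complex.add_re, Complex.add_im]; module
  zero_smul a := by ext <;> simp

end Algebra

section Lattice

variable {E : Type*} [NormedAddCommGroup E] [NormedSpace ℝ E] [Lattice E] [HasSolidNorm E]
  [IsOrderedAddMonoid E] [IsOrderedModule ℝ E] [CompleteSpace E]

/-- The modulus `|x + iy| = sup_θ ((cos θ) x + (sin θ) y)`, the supremum being taken in `E`. -/
def modulus (z : Complexification E) : E := (exists_isLUB_rotRe z.re z.im).choose

theorem isLUB_modulus (z : Complexification E) :
    IsLUB (Set.range (rotRe z.re z.im)) z.modulus := (exists_isLUB_rotRe z.re z.im).choose_spec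

theorem rotRe_le_modulus (z : Complexification E) (θ : ℝ) :
    rotRe z.re z.im θ ≤ z.modulus := z.isLUB_modulus.1 ⟨θ, rfl⟩

theorem modulus_le {z : Complexification E} {b : E} (h : ∀ θ, rotRe z.re z.im θ ≤ b) :
    z.modulus ≤ b := z.isLUB_modulus.2 (by rintro _ ⟨θ, rfl⟩; exact h θ)

theorem abs_rotRe_le_modulus (z : Complexification E) (θ : ℝ) :
    |rotRe z.re z.im θ| ≤ z.modulus :=
  abs_le'.2 ⟨z.rotRe_le_modulus θ, by
    rw [← rotRe_add_pi]; exact z.rotRe_le_modulus _⟩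

theorem modulus_nonneg (z : Complexification E) : 0 ≤ z.modulus :=
  (abs_nonneg _).trans (z.abs_rotRe_le_modulus 0)

theorem abs_re_le_modulus (z : Complexification E) : |z.re| ≤ z.modulus := by
  simpa [rotRe] using z.abs_rotRe_le_modulus 0

theorem abs_im_le_modulus (z : Complexification E) : |z.im| ≤ z.modulus := by
  simpa [rotRe] using z.abs_rotRe_le_modulus (Real.pi / 2)

theorem modulus_add_le (z w : Complexification E) :
    (z + w).modulus ≤ z.modulus + w.modulus := by
  refine modulus_le fun θ => ?_
  have : rotRe (z + w).re (z + w).im θ = rotRe z.re z.im θ + rotRe w.re w.im θ := by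
    simp only [rotRe, add_re, add_im]; module
  rw [this]
  exact add_le_add (z.rotRe_le_modulus θ) (w.rotRe_le_modulus θ)

theorem modulus_smul_le (c : ℂ) (z : Complexification E) :
    (c • z).modulus ≤ ‖c‖ • z.modulus := by
  refine modulus_le fun θ => ?_
  have : rotRe (c • z).re (c • z).im θ = ‖c‖ • rotRe z.re z.im (θ - c.arg) := by
    simp only [rotRe, smul_re, smul_im, Real.cos_sub, Real.sin_sub]
    rw [← Complex.norm_mul_cos_arg c, ← Complex.norm_mul_sin_arg c]
    module
  rw [this]
  exact smul_le_smul_of_nonneg_left (z.rotRe_le_modulus _) (norm_nonneg c)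

/-- The norm of a complex Banach lattice: `‖z‖ = ‖|z|‖`. -/
instance : Norm (Complexification E) := ⟨fun z => ‖z.modulus‖⟩

theorem norm_def (z : Complexification E) : ‖z‖ = ‖z.modulus‖ := rfl

theorem norm_le_of_modulus_le {z : Complexification E} {b : E} (h : z.modulus ≤ b) :
    ‖z‖ ≤ ‖b‖ :=
  norm_le_norm_of_abs_le_abs <| by
    rwa [abs_of_nonneg z.modulus_nonneg, abs_of_nonneg (z.modulus_nonneg.trans h)]

theorem norm_re_le (z : Complexification E) : ‖z.re‖ ≤ ‖z‖ :=
  norm_le_norm_of_abs_le_abs <| by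
    rw [abs_of_nonneg z.modulus_nonneg]; exact z.abs_re_le_modulus

theorem norm_im_le (z : Complexification E) : ‖z.im‖ ≤ ‖z‖ :=
  norm_le_norm_of_abs_le_abs <| by
    rw [abs_of_nonneg z.modulus_nonneg]; exact z.abs_im_le_modulus

theorem norm_le_add (z : Complexification E) : ‖z‖ ≤ ‖z.re‖ + ‖z.im‖ := by
  refine (norm_le_of_modulus_le (modulus_le fun θ => rotRe_le_abs_add_abs z.re z.im θ)).trans ?_
  simpa only [norm_abs_eq_norm] using norm_add_le |z.re| |z.im|

theorem norm_smul_le' (c : ℂ) (z : Complexification E) : ‖c • z‖ ≤ ‖c‖ * ‖z‖ := by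
  refine (norm_le_of_modulus_le (modulus_smul_le c z)).trans ?_
  rw [norm_smul, norm_norm, norm_def]

theorem normedSpaceCore : NormedSpace.Core ℂ (Complexification E) where
  norm_nonneg z := norm_nonneg z.modulus
  norm_smul c z := by
    refine le_antisymm (norm_smul_le' c z) ?_
    rcases eq_or_ne c 0 with rfl | hc
    · rw [norm_zero, zero_mul]
      exact norm_nonneg ((0 : ℂ) • z).modulus
    · have h := norm_smul_le' c⁻¹ (c • z)
      rw [inv_smul_smul₀ hc, norm_inv] at h
      rwa [← le_inv_mul_iff₀ (norm_pos_iff.2 hc)]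
  norm_triangle z w :=
    (norm_le_of_modulus_le (modulus_add_le z w)).trans (norm_add_le _ _)
  norm_eq_zero_iff z := by
    constructor
    · intro h
      ext
      · exact norm_le_zero_iff.1 (h ▸ z.norm_re_le)
      · exact norm_le_zero_iff.1 (h ▸ z.norm_im_le)
    · rintro rfl
      exact le_antisymm (by simpa using norm_le_add (0 : Complexification E))
        (norm_nonneg (0 : Complexification E).modulus)

instance : NormedAddCommGroup (Complexification E) :=
  NormedAddCommGroup.ofCore normedSpaceCore

instance : NormedSpace ℂ (Complexification E) := NormedSpace.ofCore normedSpaceCore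

instance : CompleteSpace (Complexification E) := by
  refine Metric.complete_of_cauchySeq_tendsto fun s hs => ?_
  rw [Metric.cauchySeq_iff] at hs
  have hre : CauchySeq fun n => (s n).re := by
    rw [Metric.cauchySeq_iff]
    intro ε hε
    obtain ⟨N, hN⟩ := hs ε hε
    refine ⟨N, fun m hm n hn => lt_of_le_of_lt ?_ (hN m hm n hn)⟩
    rw [dist_eq_norm, dist_eq_norm, ← sub_re]
    exact norm_re_le _
  have him : CauchySeq fun n => (s n).im := by
    rw [Metric.cauchySeq_iff]
    intro ε hε
    obtain ⟨N, hN⟩ := hs ε hε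
    refine ⟨N, fun m hm n hn => lt_of_le_of_lt ?_ (hN m hm n hn)⟩
    rw [dist_eq_norm, dist_eq_norm, ← sub_im]
    exact norm_im_le _
  obtain ⟨a, ha⟩ := cauchySeq_tendsto_of_complete hre
  obtain ⟨b, hb⟩ := cauchySeq_tendsto_of_complete him
  refine ⟨⟨a, b⟩, ?_⟩
  have h0 : Tendsto (fun n => ‖(s n).re - a‖ + ‖(s n).im - b‖) atTop (𝓝 0) := by
    simpa using (tendsto_iff_norm_sub_tendsto_zero.1 ha).add
      (tendsto_iff_norm_sub_tendsto_zero.1 hb)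
  rw [tendsto_iff_norm_sub_tendsto_zero]
  exact squeeze_zero (fun n => norm_nonneg _) (fun n => norm_le_add _) h0

/-- `z ≥ 0` in a complex Banach lattice: `z` is real and nonnegative. -/
def Nonneg (z : Complexification E) : Prop := z.im = 0 ∧ 0 ≤ z.re

/-- A bounded linear operator on a complex Banach lattice is positive if `T z ≥ 0` whenever
`z ≥ 0`. -/
def PositiveOp (T : Complexification E →L[ℂ] Complexification E) : Prop :=
  ∀ z : Complexification E, z.Nonneg → (T z).Nonneg

end Lattice

end Complexification

/-- Order completeness (Dedekind completeness): every nonempty subset that is bounded above has a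
supremum. A complex Banach lattice is order complete if its real part is. -/
def OrderComplete (E : Type*) [Preorder E] : Prop :=
  ∀ s : Set E, s.Nonempty → BddAbove s → ∃ a, IsLUB s a

/-! ### Operators on complex Banach spaces -/

section Operators

variable {X : Type*} [NormedAddCommGroup X] [NormedSpace ℂ X]

/-- `T` is mean ergodic if the Cesàro means `(1/n) ∑_{k<n} T^k` converge strongly to a bounded
operator. -/
def MeanErgodic (T : X →L[ℂ] X) : Prop :=
  ∃ P : X →L[ℂ] X, ∀ x : X,
    Tendsto (fun n : ℕ => (n : ℂ)⁻¹ • ∑ k ∈ Finset.range n, (T ^ k) x) atTop (𝓝 (P x))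

/-- The kernel of `c - T`. -/
def kerSub (T : X →L[ℂ] X) (c : ℂ) : Submodule ℂ X :=
  LinearMap.ker (c • LinearMap.id - (T : X →ₗ[ℂ] X))

/-- The dimension of a complex vector space, as a natural number or `∞`. -/
def edim (V : Type*) [AddCommGroup V] [Module ℂ V] : ℕ∞ := Cardinal.toENat (Module.rank ℂ V)

/-- The set of eigenvalues of `T`. -/
def pointSpectrum (T : X →L[ℂ] X) : Set ℂ := {c | kerSub T c ≠ ⊥}

/-- The set of all `θ = 2πq` with `q` rational. -/
def rationalAngles : Set ℝ := {θ | ∃ q : ℚ, θ = 2 * Real.pi * q}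

/-- The rational peripheral point spectrum
`{r(T) exp (iθ) : θ rational multiple of 2π} ∩ σ_pnt(T)`. -/
def rationalPeripheralPointSpectrum (T : X →L[ℂ] X) : Set ℂ :=
  {c | ∃ θ ∈ rationalAngles,
    c = ((spectralRadius ℂ T).toReal : ℂ) * Complex.exp (Complex.I * θ)} ∩ pointSpectrum T

end Operators

/-- A set `M` of complex numbers is cyclic if `r exp (iθ) ∈ M` (with `r ≥ 0` and `θ` real) implies
`r exp (inθ) ∈ M` for every integer `n`. -/
def CyclicSet (M : Set ℂ) : Prop :=
  ∀ r θ : ℝ, 0 ≤ r → (r : ℂ) * Complex.exp (Complex.I * θ) ∈ M →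
    ∀ n : ℤ, (r : ℂ) * Complex.exp (Complex.I * (n * θ)) ∈ M

end

set_option linter.unusedSectionVars false

/-! ### Real lattice homomorphisms on vector lattices with a strong order unit -/

namespace VectorLattice

variable {V : Type*} [AddCommGroup V] [Module ℝ V] [Lattice V] [IsOrderedAddMonoid V]
  [IsOrderedModule ℝ V]

theorem abs_smul_le (c : ℝ) (x : V) : |c • x| ≤ |c| • |x| := by
  have key : ∀ c : ℝ, c • x ≤ |c| • |x| := fun c => by
    rcases le_total 0 c with h | h
    · rw [abs_of_nonneg h]
      exact smul_le_smul_of_nonneg_left (le_abs_self x) h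
    · rw [abs_of_nonpos h]
      simpa using smul_le_smul_of_nonneg_left (neg_le_abs x) (neg_nonneg.2 h)
  exact abs_le'.2 ⟨key c, by simpa using key (-c)⟩

theorem abs_smul_of_nonneg (c : ℝ) {x : V} (hx : 0 ≤ x) : |c • x| = |c| • x := by
  rcases le_total 0 c with h | h
  · rw [abs_of_nonneg h, abs_of_nonneg (smul_nonneg h hx)]
  · rw [abs_of_nonpos h, ← abs_neg, ← neg_smul, abs_of_nonneg (smul_nonneg (neg_nonneg.2 h) hx)]

theorem eq_zero_of_abs_le_zero {x : V} (hx : |x| ≤ 0) : x = 0 :=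
  le_antisymm ((le_abs_self x).trans hx) (neg_nonpos.1 ((neg_le_abs x).trans hx))

theorem nonpos_of_le_smul_of_le_smul {a b w : V} (hab : a ⊓ b = 0) {K : ℝ} (hK : 0 < K)
    (ha : w ≤ K • a) (hb : w ≤ K • b) : w ≤ 0 := by
  have h : K⁻¹ • w ≤ 0 := by
    rw [← hab]
    exact le_inf ((inv_smul_le_iff_of_pos hK).2 ha) ((inv_smul_le_iff_of_pos hK).2 hb)
  simpa using (inv_smul_le_iff_of_pos hK).1 h

/-- A linear subspace is solid if it contains every element dominated in modulus by one of its
elements. -/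
def IsSolid (M : Submodule ℝ V) : Prop := ∀ ⦃x y : V⦄, x ∈ M → |y| ≤ |x| → y ∈ M

theorem IsSolid.mem_of_nonneg_of_le {M : Submodule ℝ V} (hM : IsSolid M) {x y : V} (hx : x ∈ M)
    (hy : 0 ≤ y) (hyx : y ≤ x) : y ∈ M :=
  hM hx (by rwa [abs_of_nonneg hy, abs_of_nonneg (hy.trans hyx)])

theorem IsSolid.abs_mem {M : Submodule ℝ V} (hM : IsSolid M) {x : V} (hx : x ∈ M) : |x| ∈ M :=
  hM hx (abs_abs x).le

/-- The solid subspace generated by a solid subspace `M` and an element `a`. -/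
def adjoin (M : Submodule ℝ V) (a : V) : Submodule ℝ V where
  carrier := {x | ∃ m ∈ M, ∃ N : ℝ, 0 ≤ m ∧ 0 ≤ N ∧ |x| ≤ m + N • a}
  zero_mem' := ⟨0, M.zero_mem, 0, le_rfl, le_rfl, by simp⟩
  add_mem' := by
    rintro x y ⟨m, hm, N, hm0, hN, hx⟩ ⟨m', hm', N', hm0', hN', hy⟩
    refine ⟨m + m', M.add_mem hm hm', N + N', add_nonneg hm0 hm0', add_nonneg hN hN',
      (abs_add_le x y).trans ((add_le_add hx hy).trans_eq ?_)⟩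
    module
  smul_mem' := by
    rintro c x ⟨m, hm, N, hm0, hN, hx⟩
    refine ⟨|c| • m, M.smul_mem _ hm, |c| * N, smul_nonneg (abs_nonneg c) hm0,
      mul_nonneg (abs_nonneg c) hN, ?_⟩
    rw [mul_smul, ← smul_add]
    refine (abs_smul_le c x).trans ?_
    exact smul_le_smul_of_nonneg_left hx (abs_nonneg c)

theorem isSolid_adjoin (M : Submodule ℝ V) (a : V) : IsSolid (adjoin M a) := by
  rintro x y ⟨m, hm, N, hm0, hN, hx⟩ hyx
  exact ⟨m, hm, N, hm0, hN, hyx.trans hx⟩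

theorem mem_adjoin_self (M : Submodule ℝ V) (a : V) (ha : 0 ≤ a) : a ∈ adjoin M a :=
  ⟨0, M.zero_mem, 1, le_rfl, zero_le_one, by simp [abs_of_nonneg ha]⟩

theorem le_adjoin {M : Submodule ℝ V} (hM : IsSolid M) (a : V) :
    M ≤ adjoin M a := fun x hx =>
  ⟨|x|, hM.abs_mem hx, 0, abs_nonneg x, le_rfl, by simp⟩

/-- Maximality among the solid subspaces that do not contain `e`. -/
def IsMaximalSolid (e : V) (M : Submodule ℝ V) : Prop :=
  Maximal (fun M : Submodule ℝ V => IsSolid M ∧ e ∉ M) M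

theorem exists_isMaximalSolid {e : V} {M₀ : Submodule ℝ V} (hM₀ : IsSolid M₀) (he : e ∉ M₀) :
    ∃ M, M₀ ≤ M ∧ IsMaximalSolid e M := by
  refine zorn_le_nonempty₀ {M : Submodule ℝ V | IsSolid M ∧ e ∉ M} ?_ M₀ ⟨hM₀, he⟩
  intro c hc hchain y hy
  have hmem : ∀ z, z ∈ sSup c ↔ ∃ M ∈ c, z ∈ M := fun z =>
    Submodule.mem_sSup_of_directed ⟨y, hy⟩ hchain.directedOn
  refine ⟨sSup c, ⟨?_, ?_⟩, fun z hz => le_sSup hz⟩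
  · intro x w hx hwx
    obtain ⟨M, hM, hxM⟩ := (hmem x).1 hx
    exact (hmem w).2 ⟨M, hM, (hc hM).1 hxM hwx⟩
  · intro h
    obtain ⟨M, hM, heM⟩ := (hmem e).1 h
    exact (hc hM).2 heM

variable {e : V}

theorem IsMaximalSolid.exists_le_add {M : Submodule ℝ V} (hM : IsMaximalSolid e M) {a : V}
    (ha : 0 ≤ a) (haM : a ∉ M) : ∃ m ∈ M, ∃ N : ℝ, 0 ≤ m ∧ 0 ≤ N ∧ e ≤ m + N • a := by
  by_contra h
  have hlt : e ∉ adjoin M a := by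
    rintro ⟨m, hm, N, hm0, hN, hx⟩
    exact h ⟨m, hm, N, hm0, hN, (le_abs_self e).trans hx⟩
  exact haM (hM.2 ⟨isSolid_adjoin M a, hlt⟩ (le_adjoin hM.1.1 a) (mem_adjoin_self M a ha))

theorem IsMaximalSolid.mem_or_mem {M : Submodule ℝ V} (hM : IsMaximalSolid e M) (he : 0 ≤ e)
    {a b : V} (ha : 0 ≤ a) (hb : 0 ≤ b) (hab : a ⊓ b = 0) : a ∈ M ∨ b ∈ M := by
  by_contra! h
  obtain ⟨m, hm, N, hm0, hN, h1⟩ := hM.exists_le_add ha h.1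
  obtain ⟨m', hm', N', hm0', hN', h2⟩ := hM.exists_le_add hb h.2
  have hw : e - (m + m') ≤ 0 := by
    refine nonpos_of_le_smul_of_le_smul hab (K := N + N' + 1) (by positivity) ?_ ?_
    · rw [sub_le_iff_le_add']
      refine h1.trans (add_le_add (le_add_of_nonneg_right hm0') ?_)
      exact smul_le_smul_of_nonneg_right (by linarith) ha
    · rw [sub_le_iff_le_add']
      refine h2.trans (add_le_add (le_add_of_nonneg_left hm0) ?_)
      exact smul_le_smul_of_nonneg_right (by linarith) hb
  exact hM.1.2 (hM.1.1.mem_of_nonneg_of_le (M.add_mem hm hm') he (sub_nonpos.1 hw))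

theorem IsMaximalSolid.exists_sub_smul_mem {M : Submodule ℝ V} (hM : IsMaximalSolid e M)
    (he : 0 ≤ e) (hunit : ∀ x : V, ∃ c : ℝ, x ≤ c • e) (x : V) : ∃ t : ℝ, x - t • e ∈ M := by
  have hsol := hM.1.1
  set A : Set ℝ := {t | (t • e - x)⁺ ∈ M} with hA
  have hneg : ∀ t : ℝ, t ∉ A → (x - t • e)⁺ ∈ M := by
    intro t ht
    have h := hM.mem_or_mem he (posPart_nonneg (t • e - x)) (negPart_nonneg (t • e - x))
      (posPart_inf_negPart_eq_zero _)
    have h2 := h.resolve_left ht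
    rwa [← posPart_neg, neg_sub] at h2
  have hne : A.Nonempty := by
    obtain ⟨c, hc⟩ := hunit (-x)
    refine ⟨-c, ?_⟩
    have : (-c) • e - x ≤ 0 := by
      rw [neg_smul, ← neg_add', neg_nonpos]
      have := add_le_add_left hc x
      rwa [neg_add_cancel] at this
    change ((-c) • e - x)⁺ ∈ M
    rw [posPart_eq_zero.2 this]
    exact M.zero_mem
  have hbdd : BddAbove A := by
    obtain ⟨c, hc⟩ := hunit x
    refine ⟨c, fun t ht => ?_⟩
    by_contra! hct
    apply hM.1.2
    have h1 : (t - c) • e ≤ (t • e - x)⁺ := by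
      refine le_trans ?_ (le_posPart _)
      rw [sub_smul]
      exact sub_le_sub_left hc _
    have h2 : (t - c) • e ∈ M :=
      hsol.mem_of_nonneg_of_le ht (smul_nonneg (sub_pos.2 hct).le he) h1
    exact (M.smul_mem_iff (sub_pos.2 hct).ne').1 h2
  refine ⟨sSup A, ?_⟩
  set s := sSup A with hs
  by_contra hx
  have hx' : |x - s • e| ∉ M := fun h => hx (hsol h (abs_abs _).ge)
  obtain ⟨m, hm, N, hm0, hN, h1⟩ := hM.exists_le_add (abs_nonneg _) hx'
  set ε : ℝ := 1 / (2 * (N + 1)) with hε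
  have hε0 : 0 < ε := by positivity
  have hNε : N * ε < 1 := by
    rw [hε, mul_one_div, div_lt_one (by positivity)]
    linarith
  obtain ⟨t, htA, hst⟩ := exists_lt_of_lt_csSup hne (sub_lt_self s hε0)
  have hlow : ((s - ε) • e - x)⁺ ∈ M := by
    refine hsol.mem_of_nonneg_of_le htA (posPart_nonneg _) (posPart_mono ?_)
    exact sub_le_sub_right (smul_le_smul_of_nonneg_right hst.le he) x
  have hup : (x - (s + ε) • e)⁺ ∈ M := by
    refine hneg _ fun h => ?_
    have := le_csSup hbdd h
    linarith
  have habs : |x - s • e| ≤ ((s - ε) • e - x)⁺ + (x - (s + ε) • e)⁺ + ε • e := by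
    rw [abs_le']
    constructor
    · have h2 : x - s • e = (x - (s + ε) • e) + ε • e := by module
      rw [h2]
      gcongr
      exact (le_posPart _).trans (le_add_of_nonneg_left (posPart_nonneg _))
    · have h2 : -(x - s • e) = ((s - ε) • e - x) + ε • e := by module
      rw [h2]
      gcongr
      exact (le_posPart _).trans (le_add_of_nonneg_right (posPart_nonneg _))
  set d := ((s - ε) • e - x)⁺ + (x - (s + ε) • e)⁺ with hd
  have hdM : d ∈ M := M.add_mem hlow hup
  have h3 : (1 - N * ε) • e ≤ m + N • d := by
    have h4 : e ≤ m + N • (d + ε • e) :=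
      h1.trans (add_le_add le_rfl (smul_le_smul_of_nonneg_left habs hN))
    have h5 : (1 - N * ε) • e = e - (N * ε) • e := by module
    rw [h5, sub_le_iff_le_add]
    refine h4.trans_eq ?_
    module
  have h6 : (1 - N * ε) • e ∈ M :=
    hsol.mem_of_nonneg_of_le (M.add_mem hm (M.smul_mem N hdM))
      (smul_nonneg (sub_pos.2 hNε).le he) h3
  exact hM.1.2 ((M.smul_mem_iff (sub_pos.2 hNε).ne').1 h6)

/-- A real lattice homomorphism with value `1` at `e`. -/
structure IsNormalizedHom (e : V) (p : V →ₗ[ℝ] ℝ) : Prop where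
  map_unit : p e = 1
  map_abs : ∀ x, p |x| = |p x|

theorem IsMaximalSolid.exists_hom {M : Submodule ℝ V} (hM : IsMaximalSolid e M)
    (he : 0 ≤ e) (hunit : ∀ x : V, ∃ c : ℝ, x ≤ c • e) :
    ∃ p : V →ₗ[ℝ] ℝ, IsNormalizedHom e p ∧ ∀ x ∈ M, p x = 0 := by
  choose p hp using hM.exists_sub_smul_mem he hunit
  have huniq : ∀ x (t : ℝ), x - t • e ∈ M → p x = t := by
    intro x t ht
    by_contra hne
    apply hM.1.2
    have h1 : (p x - t) • e ∈ M := by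
      have := M.sub_mem ht (hp x)
      convert this using 1
      module
    exact (M.smul_mem_iff (sub_ne_zero.2 hne)).1 h1
  refine ⟨⟨⟨p, fun x y => huniq _ _ ?_⟩, fun c x => huniq _ _ ?_⟩, ⟨huniq _ _ ?_, fun x =>
    huniq _ _ (hM.1.1 (hp x) ?_)⟩, fun x hx => huniq _ _ ?_⟩
  · convert M.add_mem (hp x) (hp y) using 1
    module
  · convert M.smul_mem c (hp x) using 1
    simp only [smul_eq_mul, RingHom.id_apply]
    module
  · simp
  · have h1 : |p x| • e = |p x • e| := (abs_smul_of_nonneg _ he).symm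
    change |(|x| - |p x| • e)| ≤ _
    rw [h1]
    exact abs_abs_sub_abs_le x (p x • e)
  · simpa using hx

/-- Normalized lattice homomorphisms separate the points of an Archimedean vector lattice with a
strong order unit. -/
theorem exists_normalizedHom_ne_zero (he : 0 ≤ e) (hunit : ∀ x : V, ∃ c : ℝ, x ≤ c • e)
    (harch : ∀ a b : V, (∀ n : ℕ, n • a ≤ b) → a ≤ 0) {f : V} (hf : f ≠ 0) :
    ∃ p : V →ₗ[ℝ] ℝ, IsNormalizedHom e p ∧ p f ≠ 0 := by
  have hn : ∃ n : ℕ, ¬ n • |f| ≤ e := by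
    by_contra! h
    exact hf (eq_zero_of_abs_le_zero (harch |f| e h))
  obtain ⟨n, hn⟩ := hn
  set g := n • |f| - e with hg
  have hg0 : ¬ g⁺ ≤ 0 := fun h => hn (sub_nonpos.1 ((le_posPart g).trans h))
  have hbot : IsSolid (⊥ : Submodule ℝ V) := by
    intro x y hx hyx
    rw [Submodule.mem_bot] at hx ⊢
    rw [hx, abs_zero] at hyx
    exact eq_zero_of_abs_le_zero hyx
  have heJ : e ∉ adjoin ⊥ g⁻ := by
    rintro ⟨m, hm, N, -, hN, h⟩
    rw [Submodule.mem_bot] at hm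
    rw [hm, zero_add] at h
    obtain ⟨c, hc⟩ := hunit g⁺
    refine hg0 (nonpos_of_le_smul_of_le_smul (posPart_inf_negPart_eq_zero g)
      (K := |c| * N + 1) (by positivity) ?_ ?_)
    · nth_rewrite 1 [← one_smul ℝ g⁺]
      exact smul_le_smul_of_nonneg_right (by simpa using mul_nonneg (abs_nonneg c) hN)
        (posPart_nonneg g)
    · calc g⁺ ≤ c • e := hc
        _ ≤ |c| • e := smul_le_smul_of_nonneg_right (le_abs_self c) he
        _ ≤ |c| • (N • g⁻) := smul_le_smul_of_nonneg_left ((le_abs_self e).trans h) (abs_nonneg c)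
        _ = (|c| * N) • g⁻ := (mul_smul _ _ _).symm
        _ ≤ _ := smul_le_smul_of_nonneg_right (by linarith) (negPart_nonneg g)
  obtain ⟨M, hJM, hM⟩ := exists_isMaximalSolid (isSolid_adjoin _ _) heJ
  obtain ⟨p, hp, hpM⟩ := hM.exists_hom he hunit
  refine ⟨p, hp, fun h0 => ?_⟩
  have h1 : p g⁻ = 0 := hpM _ (hJM (mem_adjoin_self _ _ (negPart_nonneg g)))
  have h2 : 0 ≤ p g⁺ := by
    rw [← abs_of_nonneg (posPart_nonneg g), hp.map_abs]
    exact abs_nonneg _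
  have h3 : p g = p g⁺ := by
    conv_lhs => rw [← posPart_sub_negPart g, map_sub, h1, sub_zero]
  have h4 : p g = -1 := by
    rw [hg, map_sub, map_nsmul, hp.map_abs, h0, hp.map_unit]
    simp
  linarith

theorem IsNormalizedHom.map_nonneg {p : V →ₗ[ℝ] ℝ} (hp : IsNormalizedHom e p) {x : V}
    (hx : 0 ≤ x) : 0 ≤ p x := by
  rw [← abs_of_nonneg hx, hp.map_abs]
  exact abs_nonneg _

theorem IsNormalizedHom.map_inf {p : V →ₗ[ℝ] ℝ} (hp : IsNormalizedHom e p) (x y : V) :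
    p (x ⊓ y) = p x ⊓ p y := by
  rw [inf_eq_half_smul_add_sub_abs_sub' ℝ, inf_eq_half_smul_add_sub_abs_sub' ℝ (p x), map_smul,
    map_sub, map_add, hp.map_abs, map_sub]

/-- Distinct normalized lattice homomorphisms have a dual family. -/
theorem exists_dual_family {ι : Type*} [Finite ι] {p : ι → V →ₗ[ℝ] ℝ}
    (hp : ∀ i, IsNormalizedHom e (p i)) (hinj : Function.Injective p) (a : ι) :
    ∃ f : V, p a f = 1 ∧ ∀ b, b ≠ a → p b f = 0 := by
  classical
  cases nonempty_fintype ι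
  have key : ∀ s : Finset ι, a ∉ s → ∃ f : V, 0 ≤ f ∧ 0 < p a f ∧ ∀ b ∈ s, p b f = 0 := by
    intro s
    induction s using Finset.induction_on with
    | empty =>
      intro _
      exact ⟨|e|, abs_nonneg e, by simp [(hp a).map_abs, (hp a).map_unit], by simp⟩
    | insert b s hb ih =>
      intro ha
      rw [Finset.mem_insert, not_or] at ha
      obtain ⟨f, hf0, hfa, hfs⟩ := ih ha.2
      have hne : p a ≠ p b := fun h => ha.1 (hinj h)
      obtain ⟨x, hx⟩ : ∃ x, p a x ≠ p b x := by
        by_contra! h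
        exact hne (LinearMap.ext h)
      refine ⟨f ⊓ |x - p b x • e|, le_inf hf0 (abs_nonneg _), ?_, ?_⟩
      · rw [(hp a).map_inf, (hp a).map_abs, map_sub, map_smul, (hp a).map_unit]
        refine lt_inf_iff.2 ⟨hfa, abs_pos.2 ?_⟩
        simpa using sub_ne_zero.2 hx
      · intro c hc
        rw [(hp c).map_inf, (hp c).map_abs]
        rcases Finset.mem_insert.1 hc with rfl | hc
        · rw [map_sub, map_smul, (hp c).map_unit]
          simpa using (hp c).map_nonneg hf0
        · rw [hfs c hc]
          exact inf_eq_left.2 (abs_nonneg _)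
  obtain ⟨f, -, hfa, hfs⟩ := key (Finset.univ.erase a) (by simp)
  refine ⟨(p a f)⁻¹ • f, ?_, fun b hb => ?_⟩
  · rw [map_smul, smul_eq_mul, inv_mul_cancel₀ hfa.ne']
  · rw [map_smul, hfs b (by simp [hb]), smul_zero]

end VectorLattice

namespace Complexification

section Map

variable {V W : Type*} [AddCommGroup V] [Module ℝ V] [AddCommGroup W] [Module ℝ W]

/-- The complexification of a real linear map. -/
def map (B : V →ₗ[ℝ] W) : Complexification V →ₗ[ℂ] Complexification W where
  toFun z := ⟨B z.re, B z.im⟩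
  map_add' z w := by ext <;> simp
  map_smul' c z := by ext <;> simp

@[simp] theorem map_re (B : V →ₗ[ℝ] W) (z : Complexification V) : (map B z).re = B z.re := rfl
@[simp] theorem map_im (B : V →ₗ[ℝ] W) (z : Complexification V) : (map B z).im = B z.im := rfl

/-- The complex linear extension of a real linear functional. -/
def toComplex (p : V →ₗ[ℝ] ℝ) : Complexification V →ₗ[ℂ] ℂ where
  toFun z := ⟨p z.re, p z.im⟩
  map_add' z w := by apply Complex.ext <;> simp
  map_smul' c z := by apply Complex.ext <;> simp

theorem toComplex_apply (p : V →ₗ[ℝ] ℝ) (z : Complexification V) :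
    toComplex p z = ⟨p z.re, p z.im⟩ := rfl

theorem toComplex_comp (p : W →ₗ[ℝ] ℝ) (B : V →ₗ[ℝ] W) (z : Complexification V) :
    toComplex (p ∘ₗ B) z = toComplex p (map B z) := rfl

theorem toComplex_real (p : V →ₗ[ℝ] ℝ) (x : V) : toComplex p ⟨x, 0⟩ = p x := by
  apply Complex.ext <;> simp [toComplex_apply]

theorem map_pow_of_eigenvector {B : V →ₗ[ℝ] V} {c : ℂ} {z : Complexification V}
    (hz : map B z = c • z) (k : ℕ) : map (B ^ k) z = c ^ k • z := by
  induction k with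
  | zero => ext <;> simp
  | succ k ih =>
    have h : map (B ^ (k + 1)) z = map B (map (B ^ k) z) := by
      ext <;> simp only [map_re, map_im, pow_succ', Module.End.mul_apply]
    rw [h, ih, LinearMap.map_smul, hz, smul_smul, pow_succ]

/-- The projection of a real vector onto the eigenspace of a root of unity. -/
theorem map_sum_eigenvector {B : V →ₗ[ℝ] V} {q : ℕ} {x : V} (hx : (B ^ q) x = x) {c : ℂ}
    (hc : c ^ q = 1) (hc0 : c ≠ 0) :
    map B (∑ k ∈ Finset.range q, (c ^ k)⁻¹ • (⟨(B ^ k) x, 0⟩ : Complexification V)) =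
      c • ∑ k ∈ Finset.range q, (c ^ k)⁻¹ • (⟨(B ^ k) x, 0⟩ : Complexification V) := by
  have hshift : ∑ k ∈ Finset.range q,
      (c ^ (k + 1))⁻¹ • (⟨(B ^ (k + 1)) x, 0⟩ : Complexification V) =
        ∑ k ∈ Finset.range q, (c ^ k)⁻¹ • (⟨(B ^ k) x, 0⟩ : Complexification V) := by
    have h1 := Finset.sum_range_succ
      (fun k => (c ^ k)⁻¹ • (⟨(B ^ k) x, 0⟩ : Complexification V)) q
    rw [Finset.sum_range_succ'] at h1
    simpa [hx, hc] using h1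
  conv_rhs => rw [← hshift]
  rw [_root_.map_sum, Finset.smul_sum]
  refine Finset.sum_congr rfl fun k _ => ?_
  rw [LinearMap.map_smul, smul_smul, pow_succ' c k, mul_inv, ← mul_assoc, mul_inv_cancel₀ hc0,
    one_mul]
  refine congrArg (fun z : Complexification V => (c ^ k)⁻¹ • z) ?_
  ext <;> simp only [map_re, map_im, pow_succ', Module.End.mul_apply, map_zero]

end Map

section Automorphism

variable {V : Type*} [AddCommGroup V] [Module ℝ V] [Lattice V] [IsOrderedAddMonoid V]
  [IsOrderedModule ℝ V]

open VectorLattice Module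

theorem exists_linearIndependent_eigenvectors {e : V} (he : 0 ≤ e)
    (hunit : ∀ x : V, ∃ c : ℝ, x ≤ c • e)
    (harch : ∀ a b : V, (∀ n : ℕ, n • a ≤ b) → a ≤ 0)
    {B : V →ₗ[ℝ] V} (hB : ∀ x, B |x| = |B x|) (hBe : B e = e) {c : ℂ} (hc : 0 < orderOf c)
    (hBq : ∀ x, (B ^ orderOf c) x = x) (W : Submodule ℂ (Complexification V))
    [FiniteDimensional ℂ W] (hW : ∀ z ∈ W, map B z = c • z) (n : ℤ) :
    ∃ g : Fin (finrank ℂ W) → Complexification V,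
      LinearIndependent ℂ g ∧ ∀ i, map B (g i) = c ^ n • g i := by
  set q := orderOf c with hq
  have hcq : c ^ q = 1 := pow_orderOf_eq_one c
  have hc0 : c ≠ 0 := by
    rintro rfl
    rw [zero_pow hc.ne'] at hcq
    exact zero_ne_one hcq
  have hBk : ∀ (k : ℕ) x, (B ^ k) |x| = |(B ^ k) x| := by
    intro k
    induction k with
    | zero => simp
    | succ k ih => intro x; simp only [pow_succ', Module.End.mul_apply, ih, hB]
  have hBke : ∀ k : ℕ, (B ^ k) e = e := by
    intro k
    induction k with
    | zero => simp
    | succ k ih => simp only [pow_succ', Module.End.mul_apply, ih, hBe]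
  let K : Set (W →ₗ[ℂ] ℂ) := {φ | ∃ p, IsNormalizedHom e p ∧ φ = toComplex p ∘ₗ W.subtype}
  have hK : Submodule.span ℂ K = ⊤ := by
    refine Submodule.span_eq_top_of_ne_zero fun z hz => ?_
    have hz' : (z : Complexification V).re ≠ 0 ∨ (z : Complexification V).im ≠ 0 := by
      by_contra! h
      exact hz (Subtype.ext (Complexification.ext h.1 h.2))
    rcases hz' with h | h
    · obtain ⟨p, hp, hpz⟩ := exists_normalizedHom_ne_zero he hunit harch h
      exact ⟨_, ⟨p, hp, rfl⟩, fun h0 => hpz (congrArg Complex.re h0)⟩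
    · obtain ⟨p, hp, hpz⟩ := exists_normalizedHom_ne_zero he hunit harch h
      exact ⟨_, ⟨p, hp, rfl⟩, fun h0 => hpz (congrArg Complex.im h0)⟩
  have hfin : finrank ℂ (Submodule.span ℂ K) = finrank ℂ W := by
    rw [hK, finrank_top]
    exact Subspace.dual_finrank_eq
  have hf := Submodule.exists_fun_fin_finrank_span_eq ℂ K
  rw [hfin] at hf
  obtain ⟨f, hfK, -, hfli⟩ := hf
  choose p hp hpf using hfK
  let P : Fin (finrank ℂ W) × Fin q → V →ₗ[ℝ] ℝ := fun a => p a.1 ∘ₗ B ^ (a.2 : ℕ)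
  have hP : ∀ a, IsNormalizedHom e (P a) := fun a =>
    ⟨by simp [P, hBke, (hp a.1).map_unit], fun x => by simp [P, hBk, (hp a.1).map_abs]⟩
  have hPf : ∀ a (z : W), toComplex (P a) z = (c ^ (a.2 : ℕ) • f a.1) z := by
    intro a z
    rw [toComplex_comp, map_pow_of_eigenvector (hW z z.2), LinearMap.map_smul, hpf]
    rfl
  have hPinj : Function.Injective P := by
    rintro ⟨i, k⟩ ⟨j, l⟩ h
    have h1 : c ^ (k : ℕ) • f i = c ^ (l : ℕ) • f j := by
      ext z
      rw [← hPf (i, k), ← hPf (j, l), h]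
    obtain rfl := hfli.eq_of_smul_apply_eq_smul_apply _ _ _ _ (pow_ne_zero _ hc0) h1
    have h2 : c ^ (k : ℕ) = c ^ (l : ℕ) := smul_left_injective ℂ (hfli.ne_zero i) h1
    have h3 : (k : ℕ) = l := pow_injOn_Iio_orderOf (Set.mem_Iio.2 k.2) (Set.mem_Iio.2 l.2) h2
    rw [Fin.ext h3]
  have hdual := fun i => exists_dual_family hP hPinj (i, (⟨0, hc⟩ : Fin q))
  choose x hx1 hx0 using hdual
  have hμq : (c ^ n) ^ q = 1 := by
    rw [← zpow_natCast, ← zpow_mul, mul_comm, zpow_mul, zpow_natCast, hcq, one_zpow]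
  have hμ0 : c ^ n ≠ 0 := zpow_ne_zero n hc0
  refine ⟨fun i => ∑ k ∈ Finset.range q, ((c ^ n) ^ k)⁻¹ • ⟨(B ^ k) (x i), 0⟩, ?_, fun i =>
    map_sum_eigenvector (hBq _) hμq hμ0⟩
  have heval : ∀ j i, toComplex (p j) (∑ k ∈ Finset.range q,
      ((c ^ n) ^ k)⁻¹ • (⟨(B ^ k) (x i), 0⟩ : Complexification V)) = if i = j then 1 else 0 := by
    intro j i
    rw [_root_.map_sum, Finset.sum_eq_single_of_mem 0 (Finset.mem_range.2 hc)]
    · have h0 : p j ((B ^ 0) (x i)) = P (j, ⟨0, hc⟩) (x i) := rfl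
      rw [LinearMap.map_smul, toComplex_real, h0]
      split_ifs with hij
      · subst hij
        simp [hx1]
      · rw [hx0 i (j, ⟨0, hc⟩) fun h => hij (Prod.ext_iff.1 h).1.symm]
        simp
    · intro k hk hk0
      have h0 : p j ((B ^ k) (x i)) = P (j, ⟨k, Finset.mem_range.1 hk⟩) (x i) := rfl
      rw [LinearMap.map_smul, toComplex_real, h0, hx0 i _ fun h => hk0 ?_]
      · simp
      · exact congrArg Fin.val (Prod.ext_iff.1 h).2
  rw [Fintype.linearIndependent_iff]
  intro a ha j
  have h1 := congrArg (toComplex (p j)) ha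
  simpa [heval] using h1

/-- The lattice structure of an ordered group in which any two elements have a supremum. -/
noncomputable abbrev latticeOfIsLUB {V : Type*} [AddCommGroup V] [PartialOrder V] [IsOrderedAddMonoid V]
    (h : ∀ x y : V, ∃ s, IsLUB {x, y} s) : Lattice V :=
  { ‹PartialOrder V› with
    sup := fun x y => (h x y).choose
    le_sup_left := fun x y => (h x y).choose_spec.1 (Set.mem_insert _ _)
    le_sup_right := fun x y => (h x y).choose_spec.1 (Set.mem_insert_of_mem _ rfl)
    sup_le := fun x y z hx hy => (h x y).choose_spec.2 (by rintro _ (rfl | rfl) <;> assumption)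
    inf := fun x y => -(h (-x) (-y)).choose
    inf_le_left := fun x y => neg_le.1 ((h (-x) (-y)).choose_spec.1 (Set.mem_insert _ _))
    inf_le_right := fun x y => neg_le.1
      ((h (-x) (-y)).choose_spec.1 (Set.mem_insert_of_mem _ rfl))
    le_inf := fun x y z hx hy => le_neg.1
      ((h (-y) (-z)).choose_spec.2 (by
        rintro _ (rfl | rfl)
        · exact neg_le_neg hx
        · exact neg_le_neg hy)) }

theorem exists_linearIndependent_eigenvectors_of_isLUB {V : Type*} [AddCommGroup V] [Module ℝ V]
    [PartialOrder V] [IsOrderedAddMonoid V] [IsOrderedModule ℝ V]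
    (hlub : ∀ x y : V, ∃ s, IsLUB {x, y} s) {e : V} (he : 0 ≤ e)
    (hunit : ∀ x : V, ∃ c : ℝ, x ≤ c • e)
    (harch : ∀ a b : V, (∀ n : ℕ, n • a ≤ b) → a ≤ 0)
    {B : V →ₗ[ℝ] V} (hB : Monotone B) (hBe : B e = e) {c : ℂ} (hc : 0 < orderOf c)
    (hBq : ∀ x, (B ^ orderOf c) x = x) (W : Submodule ℂ (Complexification V))
    [FiniteDimensional ℂ W] (hW : ∀ z ∈ W, map B z = c • z) (n : ℤ) :
    ∃ g : Fin (finrank ℂ W) → Complexification V,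
      LinearIndependent ℂ g ∧ ∀ i, map B (g i) = c ^ n • g i := by
  let : Lattice V := latticeOfIsLUB hlub
  have habs : ∀ C : V →ₗ[ℝ] V, Monotone C → ∀ x, |C x| ≤ C |x| := fun C hC x =>
    abs_le'.2 ⟨hC (le_abs_self x), by rw [← map_neg]; exact hC (neg_le_abs x)⟩
  have hmono : ∀ k : ℕ, Monotone (B ^ k) := by
    intro k
    induction k with
    | zero => exact fun x y h => h
    | succ k ih => exact fun x y h => by simpa only [pow_succ', Module.End.mul_apply] using hB (ih h)
  obtain ⟨r, hr⟩ := Nat.exists_eq_add_of_lt hc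
  rw [zero_add] at hr
  have hr1 : ∀ x, B ((B ^ r) x) = x := fun x => by
    rw [← Module.End.mul_apply, ← pow_succ', ← hr, hBq]
  have hr2 : ∀ x, (B ^ r) (B x) = x := fun x => by
    rw [← Module.End.mul_apply, ← pow_succ, ← hr, hBq]
  refine exists_linearIndependent_eigenvectors he hunit harch (fun x => le_antisymm ?_
    (habs B hB x)) hBe hc hBq W hW n
  have h1 := hB (habs (B ^ r) (hmono r) (B x))
  rwa [hr1, hr2] at h1

end Automorphism

end Complexification

namespace Complexification

open Module

section Operator

variable {E : Type*} [NormedAddCommGroup E] [NormedSpace ℝ E] [Lattice E] [HasSolidNorm E]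
  [IsOrderedAddMonoid E] [IsOrderedModule ℝ E] [CompleteSpace E]

/-- The restriction to the real part of an operator on a complex Banach lattice. -/
noncomputable def realPart (T : Complexification E →L[ℂ] Complexification E) : E →ₗ[ℝ] E where
  toFun x := (T ⟨x, 0⟩).re
  map_add' x y := by
    have : (⟨x + y, 0⟩ : Complexification E) = ⟨x, 0⟩ + ⟨y, 0⟩ := by ext <;> simp
    rw [this, map_add, add_re]
  map_smul' c x := by
    have : (⟨c • x, 0⟩ : Complexification E) = (c : ℂ) • ⟨x, 0⟩ := by
      ext
      · rw [smul_re]; simp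
      · rw [smul_im]; simp
    rw [this, map_smul, smul_re]
    simp

variable {T : Complexification E →L[ℂ] Complexification E}

theorem PositiveOp.apply_real (hT : PositiveOp T) (x : E) : T ⟨x, 0⟩ = ⟨realPart T x, 0⟩ := by
  refine Complexification.ext rfl ?_
  have h : (⟨x, 0⟩ : Complexification E) = ⟨x⁺, 0⟩ - ⟨x⁻, 0⟩ := by ext <;> simp
  rw [h, map_sub, sub_im, (hT ⟨x⁺, 0⟩ ⟨rfl, posPart_nonneg x⟩).1,
    (hT ⟨x⁻, 0⟩ ⟨rfl, negPart_nonneg x⟩).1, sub_zero]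

theorem PositiveOp.apply_eq_map (hT : PositiveOp T) (z : Complexification E) :
    T z = map (realPart T) z := by
  have h : z = ⟨z.re, 0⟩ + Complex.I • ⟨z.im, 0⟩ := by ext <;> simp
  conv_lhs => rw [h]
  rw [map_add, map_smul, hT.apply_real, hT.apply_real]
  ext <;> simp

theorem PositiveOp.monotone_realPart (hT : PositiveOp T) : Monotone (realPart T) := by
  intro x y h
  rw [← sub_nonneg, ← map_sub]
  exact (hT ⟨y - x, 0⟩ ⟨rfl, sub_nonneg.2 h⟩).2

theorem PositiveOp.pow_apply_real (hT : PositiveOp T) (k : ℕ) (x : E) :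
    (T ^ k) ⟨x, 0⟩ = ⟨(realPart T ^ k) x, 0⟩ := by
  induction k with
  | zero => rfl
  | succ k ih =>
    rw [pow_succ', mul_apply_eq_comp, ih, hT.apply_real, pow_succ',
      Module.End.mul_apply]

end Operator

end Complexification

/-- The strong limit of the Cesàro means consists of fixed vectors. -/
theorem map_eq_of_tendsto_cesaro {X : Type*} [NormedAddCommGroup X] [NormedSpace ℂ X]
    {T : X →L[ℂ] X} {x y : X}
    (h : Tendsto (fun n : ℕ => (n : ℂ)⁻¹ • ∑ k ∈ Finset.range n, (T ^ k) x) atTop (𝓝 y)) :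
    T y = y := by
  have h1 := (T.continuous.tendsto y).comp h
  have hinv : Tendsto (fun n : ℕ => (n : ℂ)⁻¹) atTop (𝓝 0) := tendsto_inv_atTop_nhds_zero_nat
  have h2 : Tendsto (fun n : ℕ => (1 + (n : ℂ)⁻¹) •
      (((n + 1 : ℕ) : ℂ)⁻¹ • ∑ k ∈ Finset.range (n + 1), (T ^ k) x) - (n : ℂ)⁻¹ • x) atTop
      (𝓝 y) := by
    have h3 := ((hinv.const_add 1).smul (h.comp (tendsto_add_atTop_nat 1))).sub
      (hinv.smul_const x)
    simpa using h3
  refine tendsto_nhds_unique (h1.congr' ?_) h2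
  filter_upwards [eventually_ge_atTop 1] with n hn
  have hn0 : (n : ℂ) ≠ 0 := by exact_mod_cast (by omega : n ≠ 0)
  have hn1 : ((n + 1 : ℕ) : ℂ) ≠ 0 := by exact_mod_cast (by omega : n + 1 ≠ 0)
  have h4 : (1 + (n : ℂ)⁻¹) * ((n + 1 : ℕ) : ℂ)⁻¹ = (n : ℂ)⁻¹ := by
    field_simp
    push_cast
    ring
  rw [smul_smul, h4, ← smul_sub, Finset.sum_range_succ', pow_zero,
    one_apply_eq_self, add_sub_cancel_right]
  simp only [Function.comp_apply, map_smul, map_sum, pow_succ', mul_apply_eq_comp]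

section Monotone

open Complexification Module

variable {E : Type*} [NormedAddCommGroup E] [NormedSpace ℝ E] [Lattice E] [HasSolidNorm E]
  [IsOrderedAddMonoid E] [IsOrderedModule ℝ E] {A : E →ₗ[ℝ] E}

theorem LinearMap.monotone_pow (hA : Monotone A) (k : ℕ) : Monotone (A ^ k) := by
  induction k with
  | zero => exact fun x y h => h
  | succ k ih =>
    intro x y h
    rw [pow_succ', Module.End.mul_apply, Module.End.mul_apply]
    exact hA (ih h)

theorem LinearMap.pow_apply_eq_self {x : E} (hx : A x = x) (k : ℕ) : (A ^ k) x = x := by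
  induction k with
  | zero => rfl
  | succ k ih => rw [pow_succ', Module.End.mul_apply, ih, hx]

theorem LinearMap.abs_map_le (hA : Monotone A) (x : E) : |A x| ≤ A |x| :=
  abs_le'.2 ⟨hA (le_abs_self x), by rw [← map_neg]; exact hA (neg_le_abs x)⟩

theorem nsmul_abs_le_sum_pow (hA : Monotone A) {q : ℕ} (hq : 0 < q) {x : E}
    (hx : (A ^ q) x = x) (n : ℕ) :
    n • |x| ≤ ∑ k ∈ Finset.range (q * n), (A ^ k) |x| := by
  have hpos : ∀ k : ℕ, 0 ≤ (A ^ k) |x| := fun k => by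
    simpa using LinearMap.monotone_pow hA k (abs_nonneg x)
  have hfix : ∀ n : ℕ, (A ^ (q * n)) x = x := by
    intro n
    induction n with
    | zero => simp
    | succ n ih => rw [mul_add, mul_one, pow_add, Module.End.mul_apply, hx, ih]
  induction n with
  | zero => simp
  | succ n ih =>
    rw [mul_add, mul_one, Finset.sum_range_add, succ_nsmul]
    refine add_le_add ih ?_
    calc |x| = |(A ^ (q * n)) x| := by rw [hfix]
      _ ≤ (A ^ (q * n + 0)) |x| := LinearMap.abs_map_le (LinearMap.monotone_pow hA _) x
      _ ≤ _ := Finset.single_le_sum (f := fun k => (A ^ (q * n + k)) |x|) (fun k _ => hpos _)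
        (Finset.mem_range.2 hq)

theorem nonpos_of_nsmul_le {a b : E} (h : ∀ n : ℕ, n • a ≤ b) : a ≤ 0 := by
  have h1 : Tendsto (fun n : ℕ => ((n : ℝ) + 1)⁻¹ • b) atTop (𝓝 0) := by
    have := (tendsto_one_div_add_atTop_nhds_zero_nat (𝕜 := ℝ)).smul_const b
    simpa using this
  refine ge_of_tendsto' h1 fun n => ?_
  rw [le_inv_smul_iff_of_pos (by positivity)]
  have := h (n + 1)
  rwa [← Nat.cast_smul_eq_nsmul ℝ, Nat.cast_succ] at this

/-- The fixed vectors of `A ^ q` that are dominated by a multiple of `e`. -/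
def boundedFixedSpace (A : E →ₗ[ℝ] E) (q : ℕ) (e : E) : Submodule ℝ E where
  carrier := {x | (A ^ q) x = x ∧ ∃ N : ℝ, |x| ≤ N • e}
  zero_mem' := ⟨map_zero _, 0, by simp⟩
  add_mem' := by
    rintro x y ⟨hx, N, hN⟩ ⟨hy, N', hN'⟩
    exact ⟨by rw [map_add, hx, hy], N + N', by
      rw [add_smul]; exact (abs_add_le x y).trans (add_le_add hN hN')⟩
  smul_mem' := by
    rintro c x ⟨hx, N, hN⟩
    refine ⟨by rw [map_smul, hx], |c| * N, (VectorLattice.abs_smul_le c x).trans ?_⟩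
    rw [mul_smul]
    exact smul_le_smul_of_nonneg_left hN (abs_nonneg c)

theorem OrderComplete.exists_isGLB (hE : OrderComplete E) {s : Set E} (hs : s.Nonempty)
    (hb : BddBelow s) : ∃ a, IsGLB s a := by
  obtain ⟨a, ha⟩ := hE (lowerBounds s) hb hs.bddAbove_lowerBounds
  exact ⟨a, isLUB_lowerBounds.1 ha⟩

/-- A least fixed point argument: the fixed space is a lattice in its own order. -/
theorem exists_isLUB_boundedFixedSpace (hE : OrderComplete E) (hA : Monotone A) {q : ℕ} {e : E}
    (he : 0 ≤ e) (hAe : A e = e) (x y : boundedFixedSpace A q e) :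
    ∃ s, IsLUB {x, y} s := by
  obtain ⟨x, hx, N, hN⟩ := x
  obtain ⟨y, hy, N', hN'⟩ := y
  have hS := LinearMap.monotone_pow hA q
  have hSe := LinearMap.pow_apply_eq_self hAe q
  set D : Set E := {w | x ≤ w ∧ y ≤ w ∧ (A ^ q) w ≤ w} with hD
  have hmem : max N N' • e ∈ D := by
    refine ⟨(le_abs_self x).trans (hN.trans ?_), (le_abs_self y).trans (hN'.trans ?_), ?_⟩
    · exact smul_le_smul_of_nonneg_right (le_max_left _ _) he
    · exact smul_le_smul_of_nonneg_right (le_max_right _ _) he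
    · rw [map_smul, hSe]
  obtain ⟨w, hw⟩ := hE.exists_isGLB ⟨_, hmem⟩ ⟨x, fun v hv => hv.1⟩
  have hwx : x ≤ w := hw.2 fun v hv => hv.1
  have hwy : y ≤ w := hw.2 fun v hv => hv.2.1
  have hSw : (A ^ q) w ≤ w := hw.2 fun v hv => (hS (hw.1 hv)).trans hv.2.2
  have hSw' : w ≤ (A ^ q) w := hw.1 ⟨by simpa only [hx] using hS hwx,
    by simpa only [hy] using hS hwy, hS hSw⟩
  have hwV : w ∈ boundedFixedSpace A q e := by
    refine ⟨le_antisymm hSw hSw', max N N', abs_le'.2 ⟨hw.1 hmem, ?_⟩⟩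
    refine (neg_le_neg hwx).trans ((neg_le_abs x).trans (hN.trans ?_))
    exact smul_le_smul_of_nonneg_right (le_max_left _ _) he
  refine ⟨⟨w, hwV⟩, ?_, fun u hu => ?_⟩
  · rintro v (rfl | rfl)
    · exact hwx
    · exact hwy
  · have hux : x ≤ (u : E) := hu (Set.mem_insert _ _)
    have huy : y ≤ (u : E) := hu (Set.mem_insert_of_mem _ rfl)
    exact hw.1 ⟨hux, huy, u.2.1.le⟩

instance Submodule.isOrderedModule (V : Submodule ℝ E) : IsOrderedModule ℝ V where
  smul_le_smul_of_nonneg_left _ hc x _ h := smul_le_smul_of_nonneg_left (b₁ := (x : E)) h hc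
  smul_le_smul_of_nonneg_right x hx _ _ h := smul_le_smul_of_nonneg_right (b := (x : E)) h hx

/-- If every fixed vector of `A ^ q`, with `q` the order of the root of unity `c`, is dominated by a
fixed vector of `A`, then independent eigenvectors for `c` yield as many for each power of `c`. -/
theorem exists_linearIndependent_eigenvectors_of_majorants (hE : OrderComplete E)
    (hA : Monotone A) {c : ℂ} (hc : 0 < orderOf c)
    (hmaj : ∀ x, (A ^ orderOf c) x = x → ∃ u, A u = u ∧ |x| ≤ u) {ι : Type*} [Fintype ι]
    {z : ι → Complexification E} (hli : LinearIndependent ℂ z)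
    (hz : ∀ i, map A (z i) = c • z i) (n : ℤ) :
    ∃ g : Fin (Fintype.card ι) → Complexification E,
      LinearIndependent ℂ g ∧ ∀ i, map A (g i) = c ^ n • g i := by
  set q := orderOf c with hq
  have hzq : ∀ i, map (A ^ q) (z i) = z i := fun i => by
    rw [map_pow_of_eigenvector (hz i), hq, pow_orderOf_eq_one, one_smul]
  have hre : ∀ i, (A ^ q) (z i).re = (z i).re := fun i => congrArg re (hzq i)
  have him : ∀ i, (A ^ q) (z i).im = (z i).im := fun i => congrArg im (hzq i)
  choose u hu hxu using fun i => hmaj _ (hre i)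
  choose v hv hyv using fun i => hmaj _ (him i)
  have hu0 : ∀ i, 0 ≤ u i := fun i => (abs_nonneg _).trans (hxu i)
  have hv0 : ∀ i, 0 ≤ v i := fun i => (abs_nonneg _).trans (hyv i)
  set e : E := ∑ i, (u i + v i) with he
  have hle : ∀ i, u i + v i ≤ e := fun i =>
    Finset.single_le_sum (f := fun i => u i + v i) (fun i _ => add_nonneg (hu0 i) (hv0 i))
      (Finset.mem_univ i)
  have he0 : 0 ≤ e := Finset.sum_nonneg fun i _ => add_nonneg (hu0 i) (hv0 i)
  have hAe : A e = e := by
    rw [he, _root_.map_sum]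
    exact Finset.sum_congr rfl fun i _ => by rw [map_add, hu, hv]
  set V := boundedFixedSpace A q e with hV
  have hcomm : ∀ x, (A ^ q) (A x) = A ((A ^ q) x) := fun x => by
    rw [← Module.End.mul_apply, ← pow_succ, pow_succ', Module.End.mul_apply]
  have hAV : ∀ x ∈ V, A x ∈ V := by
    rintro x ⟨hx, N, hN⟩
    refine ⟨by rw [hcomm, hx], N, (LinearMap.abs_map_le hA x).trans ?_⟩
    have := hA hN
    rwa [map_smul, hAe] at this
  let B : V →ₗ[ℝ] V := A.restrict hAV
  have hBpow : ∀ (k : ℕ) (x : V), (((B ^ k) x : V) : E) = (A ^ k) x := by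
    intro k x
    induction k with
    | zero => rfl
    | succ k ih =>
      rw [pow_succ', Module.End.mul_apply, pow_succ', Module.End.mul_apply, ← ih]
      rfl
  have hιB : ∀ y : Complexification V, Complexification.map V.subtype (map B y) = map A (Complexification.map V.subtype y) := fun y => rfl
  have hinj : Function.Injective (Complexification.map V.subtype) := fun a b hab =>
    Complexification.ext (Subtype.ext (congrArg re hab)) (Subtype.ext (congrArg im hab))
  have hlift : ∀ i, ∃ y, Complexification.map V.subtype y = z i := fun i =>
    ⟨⟨⟨(z i).re, hre i, 1, by
      rw [one_smul]
      exact (hxu i).trans ((le_add_of_nonneg_right (hv0 i)).trans (hle i))⟩,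
    ⟨(z i).im, him i, 1, by
      rw [one_smul]
      exact (hyv i).trans ((le_add_of_nonneg_left (hu0 i)).trans (hle i))⟩⟩, rfl⟩
  choose w hw using hlift
  have hwli : LinearIndependent ℂ w := by
    refine LinearIndependent.of_comp (Complexification.map V.subtype) ?_
    rwa [show Complexification.map V.subtype ∘ w = z from funext hw]
  have hwB : ∀ y ∈ Submodule.span ℂ (Set.range w), map B y = c • y := by
    intro y hy
    induction hy using Submodule.span_induction with
    | mem y hy =>
      obtain ⟨i, rfl⟩ := hy
      apply hinj
      rw [hιB, LinearMap.map_smul, hw, hz]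
    | zero => rw [map_zero, smul_zero]
    | add x y _ _ hx hy => rw [map_add, hx, hy, smul_add]
    | smul a x _ hx => rw [LinearMap.map_smul, hx, smul_comm]
  have hfin : FiniteDimensional ℂ (Submodule.span ℂ (Set.range w)) :=
    FiniteDimensional.span_of_finite ℂ (Set.finite_range w)
  have hmem : e ∈ V := ⟨LinearMap.pow_apply_eq_self hAe q, 1, by rw [one_smul, abs_of_nonneg he0]⟩
  have hex := exists_linearIndependent_eigenvectors_of_isLUB
    (exists_isLUB_boundedFixedSpace hE hA he0 hAe) (e := (⟨e, hmem⟩ : V)) he0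
    (fun x => by
      obtain ⟨N, hN⟩ := x.2.2
      exact ⟨N, (le_abs_self (x : E)).trans hN⟩)
    (fun a b h => nonpos_of_nsmul_le (a := (a : E)) (b := (b : E)) fun n => h n)
    (B := B) (fun x y h => hA h) (Subtype.ext hAe) hc
    (fun x => Subtype.ext ((hBpow _ x).trans x.2.1)) _ hwB n
  have hrank : finrank ℂ (Submodule.span ℂ (Set.range w)) = Fintype.card ι :=
    finrank_span_eq_card hwli
  rw [hrank] at hex
  obtain ⟨g, hgli, hg⟩ := hex
  refine ⟨fun i => Complexification.map V.subtype (g i), hgli.map' _ (LinearMap.ker_eq_bot.2 hinj), fun i => ?_⟩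
  rw [← hιB, hg, LinearMap.map_smul]

end Monotone

section Main

open Complexification Module

variable {E : Type*} [NormedAddCommGroup E] [NormedSpace ℝ E] [Lattice E] [HasSolidNorm E]
  [IsOrderedAddMonoid E] [IsOrderedModule ℝ E] [CompleteSpace E]
  {T : Complexification E →L[ℂ] Complexification E}

theorem MeanErgodic.exists_fixed_majorant (herg : MeanErgodic T) (hT : PositiveOp T) {q : ℕ}
    (hq : 0 < q) {x : E} (hx : (realPart T ^ q) x = x) :
    ∃ u, realPart T u = u ∧ |x| ≤ u := by
  obtain ⟨P, hP⟩ := herg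
  set A := realPart T with hA
  have hlim := hP ⟨|x|, 0⟩
  set y := P ⟨|x|, 0⟩ with hy
  have hfix : A y.re = y.re := by
    have h1 := congrArg re (map_eq_of_tendsto_cesaro hlim)
    rwa [hT.apply_eq_map] at h1
  have hre : Tendsto (fun n : ℕ => (n : ℝ)⁻¹ • ∑ k ∈ Finset.range n, (A ^ k) |x|) atTop
      (𝓝 y.re) := by
    rw [tendsto_iff_norm_sub_tendsto_zero] at hlim ⊢
    refine squeeze_zero (fun n => norm_nonneg _) (fun n => ?_) hlim
    refine le_trans (le_of_eq ?_) (norm_re_le _)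
    congr 1
    have h1 : ∑ k ∈ Finset.range n, (T ^ k) ⟨|x|, 0⟩ =
        ⟨∑ k ∈ Finset.range n, (A ^ k) |x|, 0⟩ := by
      induction n with
      | zero => rfl
      | succ n ih =>
        rw [Finset.sum_range_succ, ih, hT.pow_apply_real, Finset.sum_range_succ]
        ext <;> simp [hA]
    rw [h1, sub_re, smul_re]
    simp [← Complex.ofReal_natCast, ← Complex.ofReal_inv]
  refine ⟨(q : ℝ) • y.re, by rw [map_smul, hfix], ?_⟩
  have hsub : Tendsto (fun n : ℕ => q * (n + 1)) atTop atTop :=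
    tendsto_atTop_mono (fun n => n.le_succ.trans (Nat.le_mul_of_pos_left _ hq)) tendsto_id
  refine ge_of_tendsto' ((hre.comp hsub).const_smul (q : ℝ)) fun n => ?_
  have h1 := nsmul_abs_le_sum_pow hT.monotone_realPart hq hx (n + 1)
  have hq' : (0 : ℝ) < q := by exact_mod_cast hq
  have h2 : (q : ℝ) * ((q * (n + 1) : ℕ) : ℝ)⁻¹ = ((n : ℝ) + 1)⁻¹ := by
    push_cast
    field_simp
  rw [Function.comp_apply, smul_smul, h2, le_inv_smul_iff_of_pos (by positivity)]
  rwa [← Nat.cast_smul_eq_nsmul ℝ, Nat.cast_succ] at h1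

theorem mem_kerSub {X : Type*} [NormedAddCommGroup X] [NormedSpace ℂ X] {T : X →L[ℂ] X} {c : ℂ}
    {x : X} : x ∈ kerSub T c ↔ T x = c • x := by
  rw [kerSub, LinearMap.mem_ker]
  change c • x - T x = 0 ↔ _
  rw [sub_eq_zero, eq_comm]

theorem natCast_le_rank_kerSub_zpow (hE : OrderComplete E) (hT : PositiveOp T)
    (herg : MeanErgodic T) {c : ℂ} (hc : 0 < orderOf c) {m : ℕ}
    (hm : (m : Cardinal) ≤ Module.rank ℂ (kerSub T c)) (n : ℤ) :
    (m : Cardinal) ≤ Module.rank ℂ (kerSub T (c ^ n)) := by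
  obtain ⟨s, hs, hli⟩ := exists_finset_linearIndependent_of_le_rank hm
  have hli' : LinearIndependent ℂ fun i : s => ((i : kerSub T c) : Complexification E) :=
    hli.map' (kerSub T c).subtype (Submodule.ker_subtype _)
  obtain ⟨g, hgli, hg⟩ := exists_linearIndependent_eigenvectors_of_majorants hE
    hT.monotone_realPart hc (fun x hx => herg.exists_fixed_majorant hT hc hx) hli'
    (fun i => by rw [← hT.apply_eq_map, mem_kerSub.1 i.1.2]) n
  have hgT : ∀ i, g i ∈ kerSub T (c ^ n) := fun i => by
    rw [mem_kerSub, hT.apply_eq_map, hg]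
  have hgli' : LinearIndependent ℂ fun i => (⟨g i, hgT i⟩ : kerSub T (c ^ n)) :=
    LinearIndependent.of_comp (kerSub T (c ^ n)).subtype hgli
  have hcard := hgli'.cardinal_lift_le_rank
  simpa [hs] using hcard

theorem exists_orderOf_exp_pos {θ : ℝ} (hθ : θ ∈ rationalAngles) :
    0 < orderOf (Complex.exp (Complex.I * θ)) := by
  obtain ⟨r, rfl⟩ := hθ
  rw [orderOf_pos_iff, isOfFinOrder_iff_pow_eq_one]
  refine ⟨r.den, r.den_pos, ?_⟩
  rw [← Complex.exp_nat_mul, Complex.exp_eq_one_iff]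
  refine ⟨r.num, ?_⟩
  have h : (r : ℂ) * r.den = r.num := by exact_mod_cast r.mul_den_eq_num
  push_cast
  linear_combination (2 * Real.pi * Complex.I : ℂ) * h

theorem edim_kerSub_le (hE : OrderComplete E) (hT : PositiveOp T) (herg : MeanErgodic T) {θ : ℝ}
    (hθ : θ ∈ rationalAngles) (n : ℤ) :
    edim (kerSub T (Complex.exp (Complex.I * θ))) ≤
      edim (kerSub T (Complex.exp (Complex.I * (n * θ)))) := by
  have h : Complex.exp (Complex.I * (n * θ)) = Complex.exp (Complex.I * θ) ^ n := by
    rw [← Complex.exp_int_mul]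
    congr 1
    ring
  rw [h, edim, edim, ← ENat.forall_natCast_le_iff_le]
  intro m hm
  rw [Cardinal.natCast_le_toENat] at hm ⊢
  exact natCast_le_rank_kerSub_zpow hE hT herg (exists_orderOf_exp_pos hθ) hm n

theorem edim_ne_zero_iff {X : Type*} [AddCommGroup X] [Module ℂ X] (W : Submodule ℂ X) :
    edim W ≠ 0 ↔ W ≠ ⊥ := by
  rw [edim, Ne, Cardinal.toENat_eq_zero, Submodule.rank_eq_zero]

end Main

theorem mainTheorem11 {E : Type*} [NormedAddCommGroup E] [NormedSpace ℝ E] [Lattice E]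
    [HasSolidNorm E] [IsOrderedAddMonoid E] [IsOrderedModule ℝ E] [CompleteSpace E]
    (hE : OrderComplete E)
    (T : Complexification E →L[ℂ] Complexification E)
    (hpos : Complexification.PositiveOp T)
    (hr : spectralRadius ℂ T = 1)
    (herg : MeanErgodic T) :
    (∀ θ ∈ rationalAngles, ∀ n : ℤ,
      edim (kerSub T (Complex.exp (Complex.I * θ))) ≤
        edim (kerSub T (Complex.exp (Complex.I * (n * θ))))) ∧
    CyclicSet (rationalPeripheralPointSpectrum T) := by
  have hdim := fun θ (hθ : θ ∈ rationalAngles) (n : ℤ) => edim_kerSub_le hE hpos herg hθ n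
  refine ⟨hdim, ?_⟩
  rintro r θ hr0 ⟨⟨η, hη, heq⟩, hpt⟩ n
  rw [hr, ENNReal.toReal_one, Complex.ofReal_one, one_mul] at heq
  have hr1 : r = 1 := by
    have h := congrArg norm heq
    rwa [norm_mul, mul_comm Complex.I, mul_comm Complex.I, Complex.norm_exp_ofReal_mul_I,
      Complex.norm_exp_ofReal_mul_I, mul_one, Complex.norm_real, Real.norm_of_nonneg hr0] at h
  rw [heq] at hpt
  rw [hr1, Complex.ofReal_one, one_mul] at heq ⊢
  have hzpow : ∀ t : ℝ, Complex.exp (Complex.I * (n * t)) = Complex.exp (Complex.I * t) ^ n := by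
    intro t
    rw [← Complex.exp_int_mul]
    congr 1
    ring
  rw [hzpow, heq, ← hzpow]
  refine ⟨⟨n * η, ?_, ?_⟩, ?_⟩
  · obtain ⟨s, rfl⟩ := hη
    exact ⟨n * s, by push_cast; ring⟩
  · rw [hr]
    simp
  · have h1 := (edim_ne_zero_iff _).2 hpt
    refine (edim_ne_zero_iff _).1 fun h0 => h1 ?_
    exact le_zero_iff.1 ((hdim η hη n).trans_eq h0)
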